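/- Let $M$ be a smooth manifold of dimension $m\ge 3$ and let $g_1,g_2$ be smooth pseudo-Riemannian metrics on $M$, of arbitrary signature, that are conformally equivalent: $g_1=\alpha g_2$ for some positive function $\alpha\in C^\infty(M)$. Notation. For a pseudo-Riemannian metric $g$ let $R$ be the Riemann curvature tensor of its Levi-Civita connection, $R(x,y,z,w)=g(R(x,y)z,w)$ with $R(x,y)=\nabla_x\nabla_y-\nabla_y\nabla_x-\nabla_{[x,y]}$, let $\rho(x,y)=\sum_{ij}g^{ij}R(x,e_i,e_j,y)$ and $\tau=\sum_{ij}g^{ij}\rho(e_i,e_j)$, and let $W_g$ be the Weyl conformal curvature tensor $$W_g(x,y,z,w)=R(x,y,z,w)-\tfrac1{m-2}\{\rho(x,w)g(y,z)+g(x,w)\rho(y,z)\}+\tfrac1{m-2}\{\rho(x,z)g(y,w)+g(x,z)\rho(y,w)\}+\tfrac1{(m-1)(m-2)}\tau\{g(x,w)g(y,z)-g(x,z)g(y,w)\}.$$ The Jacobi operator $J_W(x)$ is defined by $g(J_W(x)y,z)=W_g(y,x,x,z)$; if $\{e_1,e_2\}$ is an oriented orthonormal basis of an oriented spacelike (positive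 definite) or timelike (negative definite) $2$-plane $\pi\subset T_PM$, the skew-symmetric curvature operator $W(\pi)$ is defined by $g(W(\pi)x,y)=W_g(e_1,e_2,x,y)$. One says that $(M,g)$ is *conformally spacelike* (resp. *timelike*) *Jordan Osserman* if for every $P\in M$ the Jordan normal form of $J_W(x)$ is the same for all $x\in T_PM$ with $g(x,x)=1$ (resp. $g(x,x)=-1$), and *conformally spacelike* (resp. *timelike*) *Jordan Ivanov-Petrova* if for every $P\in M$ the Jordan normal form of $W(\pi)$ is the same for all oriented spacelike (resp. timelike) $2$-planes $\pi\subset T_PM$. The Jordan normal forms may vary with $P$. Theorem 1.1. If $g_1=\alpha g_2$ as above, then $W_{g_1}=\alpha W_{g_2}$, and: 1. $(M,g_1)$ is conformally spacelike (resp. timelike) Jordan Osserman if and only if $(M,g_2)$ is conformally spacelike (resp. timelike) Jordan Osserman. 2. $(M,g_1)$ is conformally spacelike (resp. timelike) Jordan Ivanov-Petrova if and only if $(M,g_2)$ is conformally spacelike (resp. timelike) Jordan Ivanov-Petrova. -/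

import Mathlib

set_option maxSynthPendingDepth 3

open scoped Manifold ContDiff TensorProduct

noncomputable section

/-! ### Jordan normal form -/

/-- The `k × k` Jordan block with eigenvalue `c` (ones on the superdiagonal). -/
def jordanBlock (c : ℂ) (k : ℕ) : Matrix (Fin k) (Fin k) ℂ :=
  Matrix.of fun i j => if i = j then c else if (i : ℕ) + 1 = (j : ℕ) then 1 else 0

/-- The list `L` of pairs (eigenvalue, block size) is a Jordan normal form of the real
endomorphism `f`: in some basis of the complexification, `f` is block diagonal with the Jordan
blocks prescribed by `L`. -/
def HasJordanNormalForm {V : Type*} [AddCommGroup V] [Module ℝ V]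
    (f : V →ₗ[ℝ] V) (L : List (ℂ × ℕ)) : Prop :=
  ∃ b : Module.Basis (Σ i : Fin L.length, Fin (L.get i).2) ℂ (ℂ ⊗[ℝ] V),
    LinearMap.toMatrix b b (f.baseChange ℂ) =
      Matrix.blockDiagonal' fun i : Fin L.length => jordanBlock (L.get i).1 (L.get i).2

/-! ### Linear algebra of curvature tensors -/

/-- Elements of `⊗⁴ V*`, in curried form. -/
abbrev Tensor4 (V : Type*) [AddCommGroup V] [Module ℝ V] : Type _ :=
  V →ₗ[ℝ] V →ₗ[ℝ] V →ₗ[ℝ] V →ₗ[ℝ] ℝ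

/-- A triple `(V, g, A)`: a nondegenerate symmetric bilinear form `g` of arbitrary signature and a
tensor `A ∈ ⊗⁴ V*` on a real vector space. -/
structure CurvatureTriple (V : Type*) [AddCommGroup V] [Module ℝ V] where
  /-- The inner product. -/
  g : LinearMap.BilinForm ℝ V
  symm : ∀ x y, g x y = g y x
  nondeg : g.Nondegenerate
  /-- The curvature tensor. -/
  A : Tensor4 V

namespace CurvatureTriple

variable {V : Type*} [AddCommGroup V] [Module ℝ V] [FiniteDimensional ℝ V]

/-- The inverse matrix `g^{ij}` of `g_{ij} = g (e_i, e_j)`, for a fixed basis `e` of `V`. -/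
def gInv (𝒱 : CurvatureTriple V) :
    Matrix (Fin (Module.finrank ℝ V)) (Fin (Module.finrank ℝ V)) ℝ :=
  (Matrix.of fun i j => 𝒱.g (Module.finBasis ℝ V i) (Module.finBasis ℝ V j))⁻¹

/-- The Ricci tensor `ρ(x, y) = ∑ g^{ij} A(x, e_i, e_j, y)`. -/
def ricci (𝒱 : CurvatureTriple V) : LinearMap.BilinForm ℝ V :=
  LinearMap.mk₂ ℝ
    (fun x y => ∑ i, ∑ j,
      𝒱.gInv i j * 𝒱.A x (Module.finBasis ℝ V i) (Module.finBasis ℝ V j) y)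
    (by intros; simp [mul_add, Finset.sum_add_distrib])
    (by intros; simp [Finset.mul_sum, mul_left_comm])
    (by intros; simp [mul_add, Finset.sum_add_distrib])
    (by intros; simp [Finset.mul_sum, mul_left_comm])

/-- The scalar curvature `τ = ∑ g^{ij} ρ(e_i, e_j)`. -/
def scalar (𝒱 : CurvatureTriple V) : ℝ :=
  ∑ i, ∑ j, 𝒱.gInv i j * 𝒱.ricci (Module.finBasis ℝ V i) (Module.finBasis ℝ V j)

/-- The Weyl projection of `A`, as a function of four vectors (`m = dim V ≥ 3`). -/
def weylFun (𝒱 : CurvatureTriple V) (x y z w : V) : ℝ :=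
  let m : ℝ := (Module.finrank ℝ V : ℝ)
  𝒱.A x y z w
    - 1 / (m - 2) * (𝒱.ricci x w * 𝒱.g y z + 𝒱.g x w * 𝒱.ricci y z)
    + 1 / (m - 2) * (𝒱.ricci x z * 𝒱.g y w + 𝒱.g x z * 𝒱.ricci y w)
    + 1 / ((m - 1) * (m - 2)) * 𝒱.scalar * (𝒱.g x w * 𝒱.g y z - 𝒱.g x z * 𝒱.g y w)

/-- The Weyl projection of `A`, as an element of `⊗⁴ V*`. -/
def weyl (𝒱 : CurvatureTriple V) : Tensor4 V :=
  LinearMap.mk₂ ℝ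
    (fun x y => LinearMap.mk₂ ℝ (fun z w => 𝒱.weylFun x y z w)
      (by intros; simp only [weylFun, map_add, LinearMap.add_apply]; ring)
      (by intros; simp only [weylFun, map_smul, LinearMap.smul_apply, smul_eq_mul]; ring)
      (by intros; simp only [weylFun, map_add]; ring)
      (by intros; simp only [weylFun, map_smul, smul_eq_mul]; ring))
    (by
      intros; ext
      simp only [weylFun, map_add, LinearMap.add_apply, LinearMap.mk₂_apply]; ring)
    (by
      intros; ext
      simp only [weylFun, map_smul, LinearMap.smul_apply, LinearMap.mk₂_apply, smul_eq_mul]; ring)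
    (by
      intros; ext
      simp only [weylFun, map_add, LinearMap.add_apply, LinearMap.mk₂_apply]; ring)
    (by
      intros; ext
      simp only [weylFun, map_smul, LinearMap.smul_apply, LinearMap.mk₂_apply, smul_eq_mul]; ring)

/-- The triple `(V, g, W)` where `W` is the Weyl projection of `A`. -/
def weylTriple (𝒱 : CurvatureTriple V) : CurvatureTriple V :=
  { 𝒱 with A := 𝒱.weyl }

/-- The Jacobi operator `J(x)`, characterized by `g (J(x) y) z = A(y, x, x, z)`. -/
def jacobi (𝒱 : CurvatureTriple V) (x : V) : V →ₗ[ℝ] V :=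
  (𝒱.g.toDual 𝒱.nondeg).symm.toLinearMap ∘ₗ (𝒱.A.flip x).flip x

theorem jacobi_spec (𝒱 : CurvatureTriple V) (x y z : V) :
    𝒱.g (𝒱.jacobi x y) z = 𝒱.A y x x z := by
  simp [jacobi]

/-- The skew-symmetric curvature operator of the oriented plane with oriented orthonormal basis
`e₁, e₂`, characterized by `g (A(π) x) y = A(e₁, e₂, x, y)`. -/
def skewOperator (𝒱 : CurvatureTriple V) (e₁ e₂ : V) : V →ₗ[ℝ] V :=
  (𝒱.g.toDual 𝒱.nondeg).symm.toLinearMap ∘ₗ 𝒱.A e₁ e₂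

theorem skewOperator_spec (𝒱 : CurvatureTriple V) (e₁ e₂ x y : V) :
    𝒱.g (𝒱.skewOperator e₁ e₂ x) y = 𝒱.A e₁ e₂ x y := by
  simp [skewOperator]

/-- The Jordan normal form of the Jacobi operator is constant on the unit spacelike vectors. -/
def IsSpacelikeJordanOsserman (𝒱 : CurvatureTriple V) : Prop :=
  ∃ L : List (ℂ × ℕ), ∀ x : V, 𝒱.g x x = 1 → HasJordanNormalForm (𝒱.jacobi x) L

/-- The Jordan normal form of the Jacobi operator is constant on the unit timelike vectors. -/
def IsTimelikeJordanOsserman (𝒱 : CurvatureTriple V) : Prop :=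
  ∃ L : List (ℂ × ℕ), ∀ x : V, 𝒱.g x x = -1 → HasJordanNormalForm (𝒱.jacobi x) L

/-- The Jordan normal form of `A(π)` is constant on the oriented spacelike 2-planes `π`. Each
oriented plane is given by its oriented orthonormal bases. -/
def IsSpacelikeJordanIvanovPetrova (𝒱 : CurvatureTriple V) : Prop :=
  ∃ L : List (ℂ × ℕ), ∀ e₁ e₂ : V, 𝒱.g e₁ e₁ = 1 → 𝒱.g e₂ e₂ = 1 → 𝒱.g e₁ e₂ = 0 →
    HasJordanNormalForm (𝒱.skewOperator e₁ e₂) L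

/-- The Jordan normal form of `A(π)` is constant on the oriented timelike (that is, negative
definite) 2-planes `π`. Each oriented plane is given by its oriented orthonormal bases. -/
def IsTimelikeJordanIvanovPetrova (𝒱 : CurvatureTriple V) : Prop :=
  ∃ L : List (ℂ × ℕ), ∀ e₁ e₂ : V, 𝒱.g e₁ e₁ = -1 → 𝒱.g e₂ e₂ = -1 → 𝒱.g e₁ e₂ = 0 →
    HasJordanNormalForm (𝒱.skewOperator e₁ e₂) L

end CurvatureTriple

/-! ### Pseudo-Riemannian metrics and their curvature -/

/-- A smooth pseudo-Riemannian metric on `M`: a smooth field of symmetric nondegenerate bilinear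
forms on the tangent spaces. The signature is arbitrary. -/
structure PseudoRiemannianMetric (E : Type*) [NormedAddCommGroup E] [NormedSpace ℝ E]
    (M : Type*) [TopologicalSpace M] [ChartedSpace E M] [IsManifold 𝓘(ℝ, E) ∞ M] where
  /-- The bilinear form on each tangent space. -/
  val (x : M) : TangentSpace 𝓘(ℝ, E) x →L[ℝ] TangentSpace 𝓘(ℝ, E) x →L[ℝ] ℝ
  symm (x : M) (v w : TangentSpace 𝓘(ℝ, E) x) : val x v w = val x w v
  nondeg (x : M) (v : TangentSpace 𝓘(ℝ, E) x) (hv : ∀ w, val x v w = 0) : v = 0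
  contMDiff : ContMDiff 𝓘(ℝ, E) (𝓘(ℝ, E).prod 𝓘(ℝ, E →L[ℝ] E →L[ℝ] ℝ)) ∞
    (fun x => Bundle.TotalSpace.mk' (E →L[ℝ] E →L[ℝ] ℝ)
      (E := fun x : M => TangentSpace 𝓘(ℝ, E) x →L[ℝ] TangentSpace 𝓘(ℝ, E) x →L[ℝ] ℝ) x (val x))

/-! Levi-Civita connection and curvature of a metric `G` given on (an open part of) the vector
space `E`, that is, of a metric in local coordinates. -/

namespace LocalMetric

variable {E : Type*} [NormedAddCommGroup E] [NormedSpace ℝ E]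

/-- The Christoffel symbols of the first kind: `koszul G u v w z` is
`½ (∂ᵥ G(w, z) + ∂_w G(v, z) - ∂_z G(v, w))` at `u`. -/
def koszul (G : E → E →L[ℝ] E →L[ℝ] ℝ) (u : E) : E →L[ℝ] E →L[ℝ] E →L[ℝ] ℝ :=
  let T : E →L[ℝ] E →L[ℝ] E →L[ℝ] ℝ := fderiv ℝ G u
  let F : (E →L[ℝ] E →L[ℝ] ℝ) →L[ℝ] (E →L[ℝ] E →L[ℝ] ℝ) :=
    (ContinuousLinearMap.flipₗᵢ ℝ E E ℝ).toContinuousLinearEquiv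
  (1 / 2 : ℝ) • (T + T.flip - F ∘L T.flip)

theorem koszul_apply (G : E → E →L[ℝ] E →L[ℝ] ℝ) (u v w z : E) :
    koszul G u v w z =
      1 / 2 * (fderiv ℝ G u v w z + fderiv ℝ G u w v z - fderiv ℝ G u z v w) := by
  simp [koszul]

/-- The Christoffel symbols of the second kind: `christoffel G u v w` is the vector `Γ` with
`G(Γ, z) = koszul G u v w z` for all `z`. The Levi-Civita connection is
`∇ᵥ Z = ∂ᵥ Z + Γ(v, Z)`. -/
def christoffel (G : E → E →L[ℝ] E →L[ℝ] ℝ) (u : E) : E →L[ℝ] E →L[ℝ] E :=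
  ContinuousLinearMap.compL ℝ E (E →L[ℝ] ℝ) E (ContinuousLinearMap.inverse (G u)) ∘L koszul G u

/-- The curvature operator `R(x, y) z = ∇ₓ∇_y z - ∇_y∇ₓ z - ∇_{[x, y]} z` at `u`. -/
def curvature (G : E → E →L[ℝ] E →L[ℝ] ℝ) (u : E) : E →L[ℝ] E →L[ℝ] E →L[ℝ] E :=
  let D : E →L[ℝ] E →L[ℝ] E →L[ℝ] E := fderiv ℝ (christoffel G) u
  let C : E →L[ℝ] E →L[ℝ] E →L[ℝ] E :=
    (ContinuousLinearMap.compL ℝ E E E).bilinearComp (christoffel G u) (christoffel G u)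
  D - D.flip + (C - C.flip)

theorem curvature_apply (G : E → E →L[ℝ] E →L[ℝ] ℝ) (u x y z : E) :
    curvature G u x y z =
      fderiv ℝ (christoffel G) u x y z - fderiv ℝ (christoffel G) u y x z
        + (christoffel G u x (christoffel G u y z) - christoffel G u y (christoffel G u x z)) := by
  simp [curvature]

end LocalMetric

namespace PseudoRiemannianMetric

variable {E : Type*} [NormedAddCommGroup E] [NormedSpace ℝ E]
  {M : Type*} [TopologicalSpace M] [ChartedSpace E M] [IsManifold 𝓘(ℝ, E) ∞ M]

/-- The differential at `u` of the inverse of the preferred chart at `P`. -/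
def chartSymmDeriv (P : M) (u : E) : E →L[ℝ] E :=
  mfderiv 𝓘(ℝ, E) 𝓘(ℝ, E) (chartAt E P).symm u

/-- The metric in the coordinates of the preferred chart `φ` at `P`: the pull-back of `g` by
`φ⁻¹`. -/
def inChart (g : PseudoRiemannianMetric E M) (P : M) (u : E) : E →L[ℝ] E →L[ℝ] ℝ :=
  ContinuousLinearMap.bilinearComp (E := E) (F := E) (G := ℝ) (g.val ((chartAt E P).symm u))
    (chartSymmDeriv P u) (chartSymmDeriv P u)

/-- The curvature operator `R(x, y) z` on `T_P M`, computed in the preferred chart at `P`. The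
differential of that chart at `P` is the identification `T_P M = E` of Mathlib. -/
def curvatureAt (g : PseudoRiemannianMetric E M) (P : M) (x y z : TangentSpace 𝓘(ℝ, E) P) :
    TangentSpace 𝓘(ℝ, E) P :=
  LocalMetric.curvature (g.inChart P) (chartAt E P P) x y z

theorem curvatureAt_add_left (g : PseudoRiemannianMetric E M) (P : M)
    (v v' y z : TangentSpace 𝓘(ℝ, E) P) :
    g.curvatureAt P (v + v') y z = g.curvatureAt P v y z + g.curvatureAt P v' y z :=
  DFunLike.congr_fun (DFunLike.congr_fun (map_add (LocalMetric.curvature (g.inChart P) (chartAt E P P)) v v') y) z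

theorem curvatureAt_smul_left (g : PseudoRiemannianMetric E M) (P : M) (c : ℝ)
    (v y z : TangentSpace 𝓘(ℝ, E) P) :
    g.curvatureAt P (c • v) y z = c • g.curvatureAt P v y z :=
  DFunLike.congr_fun (DFunLike.congr_fun (map_smul (LocalMetric.curvature (g.inChart P) (chartAt E P P)) c v) y) z

theorem curvatureAt_add_mid (g : PseudoRiemannianMetric E M) (P : M)
    (v v' x z : TangentSpace 𝓘(ℝ, E) P) :
    g.curvatureAt P x (v + v') z = g.curvatureAt P x v z + g.curvatureAt P x v' z :=
  DFunLike.congr_fun (map_add (LocalMetric.curvature (g.inChart P) (chartAt E P P) x) v v') z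

theorem curvatureAt_smul_mid (g : PseudoRiemannianMetric E M) (P : M) (c : ℝ)
    (v x z : TangentSpace 𝓘(ℝ, E) P) :
    g.curvatureAt P x (c • v) z = c • g.curvatureAt P x v z :=
  DFunLike.congr_fun (map_smul (LocalMetric.curvature (g.inChart P) (chartAt E P P) x) c v) z

theorem curvatureAt_add_right (g : PseudoRiemannianMetric E M) (P : M)
    (v v' x y : TangentSpace 𝓘(ℝ, E) P) :
    g.curvatureAt P x y (v + v') = g.curvatureAt P x y v + g.curvatureAt P x y v' :=
  map_add (LocalMetric.curvature (g.inChart P) (chartAt E P P) x y) v v'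

theorem curvatureAt_smul_right (g : PseudoRiemannianMetric E M) (P : M) (c : ℝ)
    (v x y : TangentSpace 𝓘(ℝ, E) P) :
    g.curvatureAt P x y (c • v) = c • g.curvatureAt P x y v :=
  map_smul (LocalMetric.curvature (g.inChart P) (chartAt E P P) x y) c v

/-- The inner product `g_P` on `T_P M`. -/
def formAt (g : PseudoRiemannianMetric E M) (P : M) :
    LinearMap.BilinForm ℝ (TangentSpace 𝓘(ℝ, E) P) :=
  LinearMap.mk₂ ℝ (fun v w => g.val P v w) (by intros; simp) (by intros; simp)
    (by intros; simp) (by intros; simp)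

variable [FiniteDimensional ℝ E]

/-- The Riemann curvature tensor `R_P(x, y, z, w) = g_P(R(x, y) z, w)` on `T_P M`. -/
def riemannAt (g : PseudoRiemannianMetric E M) (P : M) : Tensor4 (TangentSpace 𝓘(ℝ, E) P) :=
  LinearMap.mk₂ ℝ
    (fun x y => LinearMap.mk₂ ℝ (fun z w => g.formAt P (g.curvatureAt P x y z) w)
      (by intros; simp [curvatureAt_add_right])
      (by intros; simp [curvatureAt_smul_right])
      (by intros; simp)
      (by intros; simp))
    (by intros; ext; simp [curvatureAt_add_left])
    (by intros; ext; simp [curvatureAt_smul_left])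
    (by intros; ext; simp [curvatureAt_add_mid])
    (by intros; ext; simp [curvatureAt_smul_mid])

instance instFiniteDimensionalTangent (P : M) :
    FiniteDimensional ℝ (TangentSpace 𝓘(ℝ, E) P) :=
  inferInstanceAs (FiniteDimensional ℝ E)

/-- The triple `(T_P M, g_P, R_P)`. -/
def riemannTriple (g : PseudoRiemannianMetric E M) (P : M) :
    CurvatureTriple (TangentSpace 𝓘(ℝ, E) P) where
  g := g.formAt P
  symm := g.symm P
  nondeg := ⟨fun v hv => g.nondeg P v hv,
    fun v hv => g.nondeg P v fun w => (g.symm P v w).trans (hv w)⟩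
  A := g.riemannAt P

/-- The triple `(T_P M, g_P, W_P)`, where `W_P` is the Weyl conformal curvature tensor. -/
def weylTripleAt (g : PseudoRiemannianMetric E M) (P : M) :
    CurvatureTriple (TangentSpace 𝓘(ℝ, E) P) :=
  (g.riemannTriple P).weylTriple

/-- The Weyl conformal curvature tensor `W_P` on `T_P M`. -/
def weylAt (g : PseudoRiemannianMetric E M) (P : M) : Tensor4 (TangentSpace 𝓘(ℝ, E) P) :=
  (g.weylTripleAt P).A

/-- `(M, g)` is conformally spacelike Jordan Osserman. -/
def IsConformallySpacelikeJordanOsserman (g : PseudoRiemannianMetric E M) : Prop :=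
  ∀ P : M, (g.weylTripleAt P).IsSpacelikeJordanOsserman

/-- `(M, g)` is conformally timelike Jordan Osserman. -/
def IsConformallyTimelikeJordanOsserman (g : PseudoRiemannianMetric E M) : Prop :=
  ∀ P : M, (g.weylTripleAt P).IsTimelikeJordanOsserman

/-- `(M, g)` is conformally spacelike Jordan Ivanov-Petrova. -/
def IsConformallySpacelikeJordanIvanovPetrova (g : PseudoRiemannianMetric E M) : Prop :=
  ∀ P : M, (g.weylTripleAt P).IsSpacelikeJordanIvanovPetrova

/-- `(M, g)` is conformally timelike Jordan Ivanov-Petrova. -/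
def IsConformallyTimelikeJordanIvanovPetrova (g : PseudoRiemannianMetric E M) : Prop :=
  ∀ P : M, (g.weylTripleAt P).IsTimelikeJordanIvanovPetrova

/-- `g₁ = α g₂` for the positive smooth function `α`. -/
def IsConformalScaling (α : M → ℝ) (g₁ g₂ : PseudoRiemannianMetric E M) : Prop :=
  ContMDiff 𝓘(ℝ, E) 𝓘(ℝ, ℝ) ∞ α ∧ (∀ P, 0 < α P) ∧
    ∀ (P : M) (v w : TangentSpace 𝓘(ℝ, E) P), g₁.val P v w = α P * g₂.val P v w

/-- `g₁` and `g₂` are conformally equivalent, that is, `g₁ ∈ [g₂]`. -/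
def ConformallyEquivalent (g₁ g₂ : PseudoRiemannianMetric E M) : Prop :=
  ∃ α : M → ℝ, IsConformalScaling α g₁ g₂

end PseudoRiemannianMetric

end

/-! Two independent facts are combined.

Covariance of the Weyl tensor. In a chart, put θ = ½ d(log a) and let N be its gradient for G. The
connection of `a • G` is Γ'(v, w) = Γ(v, w) + θ(v) w + θ(w) v - G(v, w) N. Differentiating this
shows that the lowered curvatures satisfy R₁ = a (R₂ + a Kulkarni-Nomizu product of g₂ with a
bilinear form S) (`exists_apply_curvature_smul`). Contracting gives the changes of ρ and τ, and all
terms in S and tr S cancel in the Weyl projection (`IsConformalChange.weyl_eq`).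

Jordan forms. Once g and W scale by the same factor a, the operators defined by g(J(x)y, z) = W(y,
x, x, z) and g(W(π)x, y) = W(e₁, e₂, x, y) do not change; only the normalization of vectors does. If
x is a unit vector for g₁, then √a x is one for g₂, and J(√a x) = a J(x). The constant Jordan form
therefore persists with eigenvalues multiplied by a⁻¹ (`HasJordanNormalForm.smul`). -/

/-! ### Jordan normal forms under scaling. -/

/-- Comparing indices as natural numbers avoids casts between the types `Fin (L.get i).2` when `L`
is replaced by a list with the same block sizes. -/
theorem blockDiagonal'_jordanBlock_apply (L : List (ℂ × ℕ))
    (p q : Σ i : Fin L.length, Fin (L.get i).2) :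
    Matrix.blockDiagonal' (fun i : Fin L.length => jordanBlock (L.get i).1 (L.get i).2) p q =
      if (p.1 : ℕ) = q.1 then
        if (p.2 : ℕ) = q.2 then (L.get p.1).1 else if (p.2 : ℕ) + 1 = q.2 then 1 else 0
      else 0 := by
  obtain ⟨i, j⟩ := p
  obtain ⟨i', j'⟩ := q
  by_cases h : i = i'
  · subst h
    simp [Matrix.blockDiagonal'_apply, jordanBlock, Fin.ext_iff]
  · have h' : (i : ℕ) ≠ i' := fun e => h (Fin.ext e)
    simp [Matrix.blockDiagonal'_apply, h, h']

/-- A Jordan normal form of `c • f` is obtained by scaling the eigenvalues. -/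
theorem HasJordanNormalForm.smul {V : Type*} [AddCommGroup V] [Module ℝ V]
    {f : V →ₗ[ℝ] V} {L : List (ℂ × ℕ)} (hf : HasJordanNormalForm f L) {c : ℝ} (hc : c ≠ 0) :
    HasJordanNormalForm (c • f) (L.map fun p => ((c : ℂ) * p.1, p.2)) := by
  obtain ⟨b, hb⟩ := hf
  have hc' : (c : ℂ) ≠ 0 := by exact_mod_cast hc
  let e : (Σ i : Fin L.length, Fin (L.get i).2) ≃
      Σ i : Fin (L.map fun p => ((c : ℂ) * p.1, p.2)).length,
        Fin ((L.map fun p => ((c : ℂ) * p.1, p.2)).get i).2 :=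
    Equiv.sigmaCongr (finCongr (by simp)) fun i => finCongr (by simp)
  have he1 (p) : ((e p).1 : ℕ) = p.1 := rfl
  have he2 (p) : ((e p).2 : ℕ) = p.2 := rfl
  have he3 (p) : ((L.map fun p => ((c : ℂ) * p.1, p.2)).get (e p).1).1 = c * (L.get p.1).1 := by
    rw [List.get_eq_getElem, List.getElem_map]
    rfl
  -- Within a block, f b_j = λ b_j + b_{j-1}. With b'_j = c⁻ʲ b_j this gives c f b'_j = cλ b'_j +
  -- b'_{j-1}, so the superdiagonal ones are restored.
  let s (p : Σ i : Fin L.length, Fin (L.get i).2) : ℂˣ := (Units.mk0 (c : ℂ) hc') ^ (-(p.2 : ℤ))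
  refine ⟨(b.unitsSMul s).reindex e, ?_⟩
  ext p q
  obtain ⟨p, rfl⟩ := e.surjective p
  obtain ⟨q, rfl⟩ := e.surjective q
  have hbpq := congrFun (congrFun hb p) q
  rw [LinearMap.toMatrix_apply, blockDiagonal'_jordanBlock_apply] at hbpq
  rw [LinearMap.toMatrix_apply, blockDiagonal'_jordanBlock_apply]
  have hsm (x) : (c • f).baseChange ℂ x = (c : ℂ) • f.baseChange ℂ x := by
    rw [LinearMap.baseChange_smul, LinearMap.smul_apply]
    exact (algebraMap_smul ℂ c _).symm
  simp only [Module.Basis.repr_reindex, Module.Basis.reindex_apply, Equiv.symm_apply_apply,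
    Finsupp.mapDomain_equiv_apply, he1, he2, Module.Basis.unitsSMul_apply, hsm,
    Module.Basis.repr_unitsSMul, Units.smul_def, map_smul,
    Finsupp.smul_apply, hbpq, smul_eq_mul, he3]
  split_ifs with h1 h2 h3
  · simp only [s, h2]
    simp [mul_left_comm, mul_inv_cancel_left₀ (pow_ne_zero _ hc')]
  · simp only [s, ← h3]
    simp [neg_add_rev, zpow_add₀ hc']
    field_simp
  · simp
  · simp

/-! ### Common scaling of the inner product and the tensor. -/

namespace CurvatureTriple

/-- Makes the hypotheses symmetric in the two triples, so that only one implication of each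
equivalence needs proof. -/
theorem scaling_symm {V : Type*} [AddCommGroup V] [Module ℝ V] {𝒱₁ 𝒱₂ : CurvatureTriple V} {a : ℝ}
    (ha : 0 < a) (hg : 𝒱₁.g = a • 𝒱₂.g) (hA : 𝒱₁.A = a • 𝒱₂.A) :
    0 < a⁻¹ ∧ 𝒱₂.g = a⁻¹ • 𝒱₁.g ∧ 𝒱₂.A = a⁻¹ • 𝒱₁.A := by
  rw [hg, hA, smul_smul, smul_smul, inv_mul_cancel₀ ha.ne', one_smul, one_smul]
  exact ⟨inv_pos.2 ha, rfl, rfl⟩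

variable {V : Type*} [AddCommGroup V] [Module ℝ V] [FiniteDimensional ℝ V]
  {𝒱₁ 𝒱₂ : CurvatureTriple V} {a : ℝ}

/-- Both sides of the defining identity acquire the same factor, and nondegeneracy determines the
operator. -/
theorem jacobi_eq_of_scaling (hg : 𝒱₁.g = a • 𝒱₂.g) (hA : 𝒱₁.A = a • 𝒱₂.A) (x : V) :
    𝒱₁.jacobi x = 𝒱₂.jacobi x := by
  ext y
  refine sub_eq_zero.1 (𝒱₁.nondeg.1 _ fun z => ?_)
  rw [map_sub, LinearMap.sub_apply, jacobi_spec, hg, hA]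
  simp [jacobi_spec]

theorem skewOperator_eq_of_scaling (hg : 𝒱₁.g = a • 𝒱₂.g) (hA : 𝒱₁.A = a • 𝒱₂.A)
    (x y : V) : 𝒱₁.skewOperator x y = 𝒱₂.skewOperator x y := by
  ext z
  refine sub_eq_zero.1 (𝒱₁.nondeg.1 _ fun w => ?_)
  rw [map_sub, LinearMap.sub_apply, skewOperator_spec, hg, hA]
  simp [skewOperator_spec]

theorem jacobi_smul (𝒱 : CurvatureTriple V) (c : ℝ) (x : V) :
    𝒱.jacobi (c • x) = (c * c) • 𝒱.jacobi x := by
  ext y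
  refine sub_eq_zero.1 (𝒱.nondeg.1 _ fun z => ?_)
  simp [jacobi_spec, mul_assoc]

theorem skewOperator_smul_smul (𝒱 : CurvatureTriple V) (c : ℝ) (x y : V) :
    𝒱.skewOperator (c • x) (c • y) = (c * c) • 𝒱.skewOperator x y := by
  ext y
  refine sub_eq_zero.1 (𝒱.nondeg.1 _ fun z => ?_)
  simp [skewOperator_spec, mul_assoc]

/-- Constancy of the Jordan normal form of the Jacobi operator on a pseudo-sphere does not change
under a common positive scaling of the inner product and the tensor. -/
theorem jordanOsserman_of_scaling (ha : 0 < a) (hg : 𝒱₁.g = a • 𝒱₂.g) (hA : 𝒱₁.A = a • 𝒱₂.A)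
    (ε : ℝ) (h : ∃ L, ∀ x : V, 𝒱₂.g x x = ε → HasJordanNormalForm (𝒱₂.jacobi x) L) :
    ∃ L, ∀ x : V, 𝒱₁.g x x = ε → HasJordanNormalForm (𝒱₁.jacobi x) L := by
  obtain ⟨L, hL⟩ := h
  refine ⟨L.map fun p => (((a⁻¹ : ℝ) : ℂ) * p.1, p.2), fun x hx => ?_⟩
  have hs : √a * √a = a := Real.mul_self_sqrt ha.le
  -- g₂(√a x, √a x) = a g₂(x, x) = g₁(x, x) = ε. The factor a produced by the quadratic dependence
  -- of J on x is undone by scaling with a⁻¹.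
  have key := (hL (√a • x) (by simpa [← mul_assoc, hs, hg] using hx)).smul (inv_ne_zero ha.ne')
  rwa [jacobi_smul, hs, smul_smul, inv_mul_cancel₀ ha.ne', one_smul,
    ← jacobi_eq_of_scaling hg hA] at key

/-- Constancy of the Jordan normal form of the skew-symmetric curvature operator on oriented
definite 2-planes does not change under a common positive scaling of the inner product and the
tensor. -/
theorem jordanIvanovPetrova_of_scaling (ha : 0 < a) (hg : 𝒱₁.g = a • 𝒱₂.g)
    (hA : 𝒱₁.A = a • 𝒱₂.A) (ε : ℝ)
    (h : ∃ L, ∀ x y : V, 𝒱₂.g x x = ε → 𝒱₂.g y y = ε → 𝒱₂.g x y = 0 →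
      HasJordanNormalForm (𝒱₂.skewOperator x y) L) :
    ∃ L, ∀ x y : V, 𝒱₁.g x x = ε → 𝒱₁.g y y = ε → 𝒱₁.g x y = 0 →
      HasJordanNormalForm (𝒱₁.skewOperator x y) L := by
  obtain ⟨L, hL⟩ := h
  refine ⟨L.map fun p => (((a⁻¹ : ℝ) : ℂ) * p.1, p.2), fun x y hx hy hxy => ?_⟩
  have hs : √a * √a = a := Real.mul_self_sqrt ha.le
  have key := (hL (√a • x) (√a • y) (by simpa [← mul_assoc, hs, hg] using hx)
    (by simpa [← mul_assoc, hs, hg] using hy)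
    (by simpa [← mul_assoc, hs, hg] using hxy)).smul (inv_ne_zero ha.ne')
  rwa [skewOperator_smul_smul, hs, smul_smul, inv_mul_cancel₀ ha.ne', one_smul,
    ← skewOperator_eq_of_scaling hg hA] at key

end CurvatureTriple

/-! ### Metric contractions and conformal covariance of the Weyl projection. -/

namespace CurvatureTriple

variable {V : Type*} [AddCommGroup V] [Module ℝ V] [FiniteDimensional ℝ V]
  {𝒱₁ 𝒱₂ : CurvatureTriple V} {a : ℝ}

theorem gram_eq_toMatrix (𝒱 : CurvatureTriple V) :
    (Matrix.of fun i j => 𝒱.g (Module.finBasis ℝ V i) (Module.finBasis ℝ V j)) =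
      LinearMap.BilinForm.toMatrix (Module.finBasis ℝ V) 𝒱.g := by
  ext i j
  simp [LinearMap.BilinForm.toMatrix_apply]

theorem isUnit_det_gram (𝒱 : CurvatureTriple V) :
    IsUnit (Matrix.of fun i j =>
      𝒱.g (Module.finBasis ℝ V i) (Module.finBasis ℝ V j)).det := by
  rw [gram_eq_toMatrix, isUnit_iff_ne_zero]
  exact (LinearMap.BilinForm.nondegenerate_iff_det_ne_zero _).1 𝒱.nondeg

theorem sum_gInv_mul_g (𝒱 : CurvatureTriple V) (j k : Fin (Module.finrank ℝ V)) :
    ∑ i, 𝒱.gInv j i * 𝒱.g (Module.finBasis ℝ V i) (Module.finBasis ℝ V k) =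
      if j = k then 1 else 0 := by
  have h := congrFun (congrFun (Matrix.nonsing_inv_mul _ 𝒱.isUnit_det_gram) j) k
  rwa [Matrix.mul_apply, Matrix.one_apply] at h

theorem gInv_comm (𝒱 : CurvatureTriple V) (i j : Fin (Module.finrank ℝ V)) :
    𝒱.gInv i j = 𝒱.gInv j i := by
  have h : (Matrix.of fun i j =>
      𝒱.g (Module.finBasis ℝ V i) (Module.finBasis ℝ V j)).IsSymm := by
    ext i j
    exact 𝒱.symm _ _
  exact (congrFun (congrFun h.inv j) i)

/-- The trace of a bilinear form with respect to the inner product. -/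
noncomputable def trace (𝒱 : CurvatureTriple V) (B : LinearMap.BilinForm ℝ V) : ℝ :=
  ∑ i, ∑ j, 𝒱.gInv i j * B (Module.finBasis ℝ V i) (Module.finBasis ℝ V j)

/-- Contracting a linear form with the inner product returns the linear form. -/
theorem sum_gInv_contract (𝒱 : CurvatureTriple V) (f : V →ₗ[ℝ] ℝ) (w : V) :
    ∑ i, ∑ j, 𝒱.gInv i j * (f (Module.finBasis ℝ V i) * 𝒱.g (Module.finBasis ℝ V j) w) = f w := by
  -- Both sides are linear in w, so it suffices to test on the basis, where g⁻¹g = 1 applies.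
  suffices h : (∑ i, ∑ j, 𝒱.gInv i j • f (Module.finBasis ℝ V i) •
      𝒱.g (Module.finBasis ℝ V j)) = f by
    simpa using LinearMap.congr_fun h w
  refine (Module.finBasis ℝ V).ext fun k => ?_
  have h (i) : ∑ j, 𝒱.gInv i j * (f (Module.finBasis ℝ V i) *
      𝒱.g (Module.finBasis ℝ V j) (Module.finBasis ℝ V k)) =
      f (Module.finBasis ℝ V i) * if i = k then 1 else 0 := by
    rw [← sum_gInv_mul_g, Finset.mul_sum]
    exact Finset.sum_congr rfl fun j _ => by ring
  simp [h]

theorem sum_gInv_contract' (𝒱 : CurvatureTriple V) (f : V →ₗ[ℝ] ℝ) (w : V) :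
    ∑ i, ∑ j, 𝒱.gInv i j * (f (Module.finBasis ℝ V j) * 𝒱.g (Module.finBasis ℝ V i) w) = f w := by
  rw [Finset.sum_comm, ← 𝒱.sum_gInv_contract f w]
  simp only [𝒱.gInv_comm]

theorem trace_g (𝒱 : CurvatureTriple V) : 𝒱.trace 𝒱.g = Module.finrank ℝ V := by
  have h (i) : ∑ j, 𝒱.gInv i j *
      𝒱.g (Module.finBasis ℝ V i) (Module.finBasis ℝ V j) = 1 := by
    simpa [𝒱.symm (Module.finBasis ℝ V i)] using 𝒱.sum_gInv_mul_g i i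
  simp [trace, h]

theorem gInv_of_scaling (hg : 𝒱₁.g = a • 𝒱₂.g) (ha : a ≠ 0) (i j : Fin (Module.finrank ℝ V)) :
    𝒱₁.gInv i j = a⁻¹ * 𝒱₂.gInv i j := by
  have h : (Matrix.of fun i j => 𝒱₁.g (Module.finBasis ℝ V i) (Module.finBasis ℝ V j)) =
      a • Matrix.of fun i j => 𝒱₂.g (Module.finBasis ℝ V i) (Module.finBasis ℝ V j) := by
    ext i j
    simp [hg]
  have h' : 𝒱₁.gInv = a⁻¹ • 𝒱₂.gInv := by
    refine Matrix.inv_eq_left_inv ?_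
    rw [h, gInv, Matrix.smul_mul, Matrix.mul_smul, smul_smul, inv_mul_cancel₀ ha, one_smul,
      Matrix.nonsing_inv_mul _ 𝒱₂.isUnit_det_gram]
  simp [h']

/-- The inner products of `𝒱₁` and `𝒱₂` differ by the factor `a`, and the tensors by the factor `a`
and the Kulkarni-Nomizu product of `S` and the inner product. -/
structure IsConformalChange (𝒱₁ 𝒱₂ : CurvatureTriple V) (a : ℝ) (S : LinearMap.BilinForm ℝ V) :
    Prop where
  ne_zero : a ≠ 0
  g_eq : 𝒱₁.g = a • 𝒱₂.g
  A_eq (x y z w : V) : 𝒱₁.A x y z w = a * (𝒱₂.A x y z w + S x z * 𝒱₂.g y w - S y z * 𝒱₂.g x w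
    - 𝒱₂.g y z * S x w + 𝒱₂.g x z * S y w)

namespace IsConformalChange

variable {S : LinearMap.BilinForm ℝ V}

/-- The factor a of the tensor cancels against a⁻¹ from the inverse metric. The four Kulkarni-Nomizu
terms contract to S, -(tr S) g, -m S and S. -/
theorem ricci_eq (h : IsConformalChange 𝒱₁ 𝒱₂ a S) (x y : V) :
    𝒱₁.ricci x y = 𝒱₂.ricci x y + (2 - (Module.finrank ℝ V : ℝ)) * S x y
      - 𝒱₂.trace S * 𝒱₂.g x y := by
  have h1 := 𝒱₂.sum_gInv_contract' (S x) y
  have h2 := 𝒱₂.sum_gInv_contract (S.flip y) x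
  have h3 := 𝒱₂.trace_g
  simp only [LinearMap.BilinForm.flip_apply] at h2
  have ha := h.ne_zero
  have key : 𝒱₁.ricci x y = 𝒱₂.ricci x y
      + (∑ i, ∑ j, 𝒱₂.gInv i j * (S x (Module.finBasis ℝ V j) * 𝒱₂.g (Module.finBasis ℝ V i) y))
      - 𝒱₂.trace S * 𝒱₂.g x y - 𝒱₂.trace 𝒱₂.g * S x y
      + ∑ i, ∑ j, 𝒱₂.gInv i j * (S (Module.finBasis ℝ V i) y *
        𝒱₂.g (Module.finBasis ℝ V j) x) := by
    simp only [ricci, LinearMap.mk₂_apply, trace, Finset.sum_mul, ← Finset.sum_add_distrib,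
      ← Finset.sum_sub_distrib]
    refine Finset.sum_congr rfl fun i _ => Finset.sum_congr rfl fun j _ => ?_
    rw [gInv_of_scaling h.g_eq ha, h.A_eq, 𝒱₂.symm (Module.finBasis ℝ V j) x]
    field_simp
  rw [key, h1, h2, h3]
  ring

/-- Trace of `ricci_eq`: (2 - m) tr S - m tr S = -2(m - 1) tr S, and the second inverse metric
leaves a factor a⁻¹. -/
theorem scalar_eq (h : IsConformalChange 𝒱₁ 𝒱₂ a S) :
    𝒱₁.scalar = a⁻¹ * (𝒱₂.scalar - 2 * ((Module.finrank ℝ V : ℝ) - 1) * 𝒱₂.trace S) := by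
  have h3 := 𝒱₂.trace_g
  have key : 𝒱₁.scalar = a⁻¹ * (𝒱₂.scalar
      + (2 - (Module.finrank ℝ V : ℝ)) * (∑ i, ∑ j, 𝒱₂.gInv i j *
        S (Module.finBasis ℝ V i) (Module.finBasis ℝ V j))
      - 𝒱₂.trace S * ∑ i, ∑ j, 𝒱₂.gInv i j *
        𝒱₂.g (Module.finBasis ℝ V i) (Module.finBasis ℝ V j)) := by
    simp only [scalar, Finset.mul_sum, ← Finset.sum_add_distrib, ← Finset.sum_sub_distrib]
    refine Finset.sum_congr rfl fun i _ => Finset.sum_congr rfl fun j _ => ?_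
    rw [gInv_of_scaling h.g_eq h.ne_zero, h.ricci_eq]
    ring
  rw [trace] at h3
  rw [key, h3, ← trace]
  ring

/-- The Weyl projection is conformally covariant. -/
theorem weyl_eq (h : IsConformalChange 𝒱₁ 𝒱₂ a S) (hdim : 3 ≤ Module.finrank ℝ V) :
    𝒱₁.weyl = a • 𝒱₂.weyl := by
  ext x y z w
  have hm : (3 : ℝ) ≤ Module.finrank ℝ V := by exact_mod_cast hdim
  have hm1 : (Module.finrank ℝ V : ℝ) - 1 ≠ 0 := by linarith
  have hm2 : (Module.finrank ℝ V : ℝ) - 2 ≠ 0 := by linarith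
  have ha := h.ne_zero
  -- The (2 - m) S in ρ, divided by m - 2, cancels the Kulkarni-Nomizu terms; the tr S terms of ρ
  -- contribute 2/(m - 2), which is cancelled by 2(m - 1)/((m - 1)(m - 2)) from τ.
  simp only [weyl, LinearMap.mk₂_apply, LinearMap.smul_apply, weylFun, h.ricci_eq, h.scalar_eq,
    h.A_eq, h.g_eq, smul_eq_mul]
  field_simp
  ring

end IsConformalChange

end CurvatureTriple

/-! ### Conformal change of connection and curvature in coordinates. -/

namespace LocalMetric

open Topology

variable {E : Type*} [NormedAddCommGroup E] [NormedSpace ℝ E]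
  {G : E → E →L[ℝ] E →L[ℝ] ℝ} {a : E → ℝ} {u : E}

theorem apply_christoffel (hinv : (G u).IsInvertible) (v w z : E) :
    G u (christoffel G u v w) z = koszul G u v w z := by
  have h : christoffel G u v w = (G u).inverse (koszul G u v w) := rfl
  rw [h, hinv.self_apply_inverse]

theorem fderiv_apply_comm (hsymm : ∀ u v w, G u v w = G u w v) (hG : DifferentiableAt ℝ G u)
    (x v w : E) : fderiv ℝ G u x v w = fderiv ℝ G u x w v := by
  have h (v w : E) := ((hG.hasFDerivAt.clm_apply (hasFDerivAt_const v u)).clm_apply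
    (hasFDerivAt_const w u))
  have h1 := h v w
  have h2 := h w v
  simp only [hsymm _ v w] at h1
  simpa using DFunLike.congr_fun (h1.unique h2) x

/-- The Levi-Civita connection is torsion-free. -/
theorem christoffel_comm (hsymm : ∀ u v w, G u v w = G u w v) (hG : DifferentiableAt ℝ G u)
    (hinv : (G u).IsInvertible) (v w : E) : christoffel G u v w = christoffel G u w v := by
  refine hinv.injective (ContinuousLinearMap.ext fun z => ?_)
  rw [apply_christoffel hinv, apply_christoffel hinv, koszul_apply, koszul_apply,
    fderiv_apply_comm hsymm hG z v w]
  ring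

/-- The Levi-Civita connection is metric. -/
theorem fderiv_eq_christoffel (hsymm : ∀ u v w, G u v w = G u w v) (hG : DifferentiableAt ℝ G u)
    (hinv : (G u).IsInvertible) (x v w : E) :
    fderiv ℝ G u x v w = G u (christoffel G u x v) w + G u v (christoffel G u x w) := by
  rw [hsymm u v, apply_christoffel hinv, apply_christoffel hinv, koszul_apply, koszul_apply,
    fderiv_apply_comm hsymm hG x w v, fderiv_apply_comm hsymm hG w x v,
    fderiv_apply_comm hsymm hG v x w]
  ring

theorem isInvertible_smul {F₁ F₂ : Type*} [NormedAddCommGroup F₁] [NormedSpace ℝ F₁]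
    [NormedAddCommGroup F₂] [NormedSpace ℝ F₂] {f : F₁ →L[ℝ] F₂} (hf : f.IsInvertible) {c : ℝ}
    (hc : c ≠ 0) : (c • f).IsInvertible := by
  obtain ⟨e, rfl⟩ := hf
  refine ContinuousLinearMap.IsInvertible.of_inverse (g := c⁻¹ • (e.symm : F₂ →L[ℝ] F₁)) ?_ ?_ <;>
  · ext
    simp [hc]

/-- The logarithmic differential `½ d(log a)`. -/
noncomputable def halfLogDeriv (a : E → ℝ) (u : E) : E →L[ℝ] ℝ :=
  fderiv ℝ (fun u => 1 / 2 * Real.log (a u)) u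

theorem fderiv_eq_halfLogDeriv (ha : DifferentiableAt ℝ a u) (hpos : 0 < a u) (v : E) :
    fderiv ℝ a u v = 2 * a u * halfLogDeriv a u v := by
  have h := (ha.hasFDerivAt.log hpos.ne').const_mul (1 / 2)
  rw [halfLogDeriv, h.fderiv]
  simp
  field_simp

/-- The Christoffel symbols of a conformal metric. -/
theorem apply_christoffel_smul (ha : DifferentiableAt ℝ a u) (hpos : 0 < a u)
    (hG : DifferentiableAt ℝ G u) (hinv : (G u).IsInvertible) (v w z : E) :
    G u (christoffel (fun u => a u • G u) u v w) z = G u (christoffel G u v w) z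
      + halfLogDeriv a u v * G u w z + halfLogDeriv a u w * G u v z
      - halfLogDeriv a u z * G u v w := by
  have h := apply_christoffel (G := fun u => a u • G u) (isInvertible_smul hinv hpos.ne') v w z
  have hd := (ha.hasFDerivAt.fun_smul hG.hasFDerivAt).fderiv
  rw [koszul_apply, hd] at h
  simp only [add_apply, smul_apply,
    ContinuousLinearMap.smulRight_apply, smul_eq_mul, fderiv_eq_halfLogDeriv ha hpos] at h
  rw [apply_christoffel hinv, koszul_apply]
  refine mul_left_cancel₀ hpos.ne' ?_
  rw [h]
  ring

/-- The derivative of θ is the Hessian of ½ log a. -/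
theorem halfLogDeriv_symm (ha : ContDiffAt ℝ 2 a u) (hpos : 0 < a u) (x y : E) :
    fderiv ℝ (halfLogDeriv a) u x y = fderiv ℝ (halfLogDeriv a) u y x := by
  have : ContDiffAt ℝ 2 (fun u => 1 / 2 * Real.log (a u)) u :=
    contDiffAt_const.mul (ha.log hpos.ne')
  exact (this.isSymmSndFDerivAt (by simp)).eq x y

section Smooth

variable [FiniteDimensional ℝ E]

theorem eventually_isInvertible (hG : ContinuousAt G u) (hinv : (G u).IsInvertible) :
    ∀ᶠ v in 𝓝 u, (G v).IsInvertible := by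
  obtain ⟨e, he⟩ := hinv
  exact hG.eventually (he ▸ ContinuousLinearEquiv.nhds e)

theorem differentiableAt_christoffel (hG : ContDiffAt ℝ 2 G u) (hinv : (G u).IsInvertible) :
    DifferentiableAt ℝ (christoffel G) u := by
  have h1 : ContDiffAt ℝ 1 (fun v => (G v).inverse) u :=
    (hinv.contDiffAt_map_inverse).comp u (hG.of_le one_le_two)
  have h2 : DifferentiableAt ℝ (fderiv ℝ G) u :=
    (hG.fderiv_right (m := 1) (by norm_num)).differentiableAt one_ne_zero
  have h3 : DifferentiableAt ℝ (koszul G) u := by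
    let F : (E →L[ℝ] E →L[ℝ] ℝ) →L[ℝ] (E →L[ℝ] E →L[ℝ] ℝ) :=
      (ContinuousLinearMap.flipₗᵢ ℝ E E ℝ).toContinuousLinearEquiv
    have hflip : DifferentiableAt ℝ (fun v => (fderiv ℝ G v).flip) u :=
      (ContinuousLinearMap.flipₗᵢ ℝ E E (E →L[ℝ] ℝ)).toContinuousLinearEquiv.differentiableAt.comp
        u h2
    exact ((h2.add hflip).sub ((differentiableAt_const F).clm_comp hflip)).const_smul (1 / 2 : ℝ)
  exact ((ContinuousLinearMap.compL ℝ E (E →L[ℝ] ℝ) E).differentiableAt.comp u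
    (h1.differentiableAt one_ne_zero)).clm_comp h3

/-- The derivative of the Christoffel symbols of a conformal metric. -/
theorem apply_fderiv_christoffel_smul (hG : ContDiffAt ℝ 2 G u) (hinv : (G u).IsInvertible)
    (ha : ContDiffAt ℝ 2 a u) (hpos : ∀ u, 0 < a u) (x y z w : E) :
    fderiv ℝ G u x (christoffel (fun u => a u • G u) u y z) w
        + G u (fderiv ℝ (christoffel fun u => a u • G u) u x y z) w =
      fderiv ℝ G u x (christoffel G u y z) w + G u (fderiv ℝ (christoffel G) u x y z) w
      + (fderiv ℝ (halfLogDeriv a) u x y * G u z w + halfLogDeriv a u y * fderiv ℝ G u x z w)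
      + (fderiv ℝ (halfLogDeriv a) u x z * G u y w + halfLogDeriv a u z * fderiv ℝ G u x y w)
      - (fderiv ℝ (halfLogDeriv a) u x w * G u y z
        + halfLogDeriv a u w * fderiv ℝ G u x y z) := by
  have hθ : HasFDerivAt (halfLogDeriv a) (fderiv ℝ (halfLogDeriv a) u) u := by
    refine DifferentiableAt.hasFDerivAt ?_
    have : ContDiffAt ℝ 2 (fun u => 1 / 2 * Real.log (a u)) u :=
      contDiffAt_const.mul (ha.log (hpos u).ne')
    exact (this.fderiv_right (m := 1) (by norm_num)).differentiableAt one_ne_zero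
  have hG' := (hG.differentiableAt two_ne_zero).hasFDerivAt
  have hΓ := (differentiableAt_christoffel hG hinv).hasFDerivAt
  have hΓ' := (differentiableAt_christoffel (G := fun u => a u • G u) (ha.smul hG)
    (isInvertible_smul hinv (hpos u).ne')).hasFDerivAt
  have c (v : E) : HasFDerivAt (fun _ : E => v) (0 : E →L[ℝ] E) u := hasFDerivAt_const v u
  have hl := (hG'.clm_apply ((hΓ'.clm_apply (c y)).clm_apply (c z))).clm_apply (c w)
  have h0 := (hG'.clm_apply ((hΓ.clm_apply (c y)).clm_apply (c z))).clm_apply (c w)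
  have hg (v v' : E) := (hG'.clm_apply (c v)).clm_apply (c v')
  have ht (v v' v'' : E) := (hθ.clm_apply (c v)).mul (hg v' v'')
  have hr := ((h0.add (ht y z w)).add (ht z y w)).sub (ht w y z)
  -- The formula for Γ' is differentiated while paired with G, so the derivative of the inverse of G
  -- never has to be computed. It must hold near u, hence the openness of invertibility and of the
  -- C² condition.
  have heq : (fun u => G u (christoffel (fun u => a u • G u) u y z) w) =ᶠ[𝓝 u]
      fun u => G u (christoffel G u y z) w + halfLogDeriv a u y * G u z w
        + halfLogDeriv a u z * G u y w - halfLogDeriv a u w * G u y z := by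
    filter_upwards [eventually_isInvertible hG.continuousAt hinv,
      hG.eventually (by simp), ha.eventually (by simp)] with v h1 h2 h3
    exact apply_christoffel_smul (h3.differentiableAt two_ne_zero) (hpos v)
      (h2.differentiableAt two_ne_zero) h1 y z w
  have key := DFunLike.congr_fun (hl.unique (hr.congr_of_eventuallyEq heq)) x
  simp at key
  linear_combination key

/-- The curvature of the conformal metric `a • G` differs from that of `G` by the Kulkarni-Nomizu
product of `G` and a symmetric bilinear form, the negative of the change of the Schouten tensor. -/
theorem exists_apply_curvature_smul (hsymm : ∀ u v w, G u v w = G u w v) (hG : ContDiffAt ℝ 2 G u)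
    (hinv : (G u).IsInvertible) (ha : ContDiffAt ℝ 2 a u) (hpos : ∀ u, 0 < a u) :
    ∃ S : LinearMap.BilinForm ℝ E, ∀ x y z w,
      G u (curvature (fun u => a u • G u) u x y z) w =
        G u (curvature G u x y z) w + S x z * G u y w - S y z * G u x w
          - G u y z * S x w + G u x z * S y w := by
  have hG1 := hG.differentiableAt two_ne_zero
  have H1 := apply_fderiv_christoffel_smul hG hinv ha hpos
  have H2 := apply_christoffel_smul (ha.differentiableAt two_ne_zero) (hpos u) hG1 hinv
  have H4 := fderiv_eq_christoffel hsymm hG1 hinv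
  have H5 := christoffel_comm hsymm hG1 hinv
  have H6 := halfLogDeriv_symm ha (hpos u)
  have H7 := hsymm u
  -- N is the gradient of ½ log a with respect to G.
  obtain ⟨N, hN⟩ := hinv.surjective (halfLogDeriv a u)
  simp only [curvature_apply]
  set Γ' := christoffel (fun u => a u • G u) u
  set Γ := christoffel G u
  set D' := fderiv ℝ (christoffel fun u => a u • G u) u
  set D := fderiv ℝ (christoffel G) u
  set θ := halfLogDeriv a u
  set T := fderiv ℝ (halfLogDeriv a) u
  have H3 (w) : G u N w = θ w := by rw [hN]
  have H2' (v w) : Γ' v w = Γ v w + θ v • w + θ w • v - G u v w • N := by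
    refine hinv.injective (ContinuousLinearMap.ext fun z => ?_)
    rw [H2]
    simp [H3, mul_comm]
  -- S = ∇θ - θ ⊗ θ + ½ |θ|² G, where the first two terms are ∇θ and θ(N) = |θ|².
  refine ⟨LinearMap.mk₂ ℝ (fun x z => T x z - θ (Γ x z) - θ x * θ z + 1 / 2 * θ N * G u x z)
    ?_ ?_ ?_ ?_, fun x y z w => ?_⟩
  · intros; simp; ring
  · intros; simp; ring
  · intros; simp; ring
  · intros; simp; ring
  · have e1 := H1 x y z w
    have e2 := H1 y x z w
    simp only [H4, H2', map_add, map_sub, map_smul, add_apply, sub_apply, smul_apply, smul_eq_mul,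
      H3, LinearMap.mk₂_apply, H5 y x, H7 _ N] at e1 e2 ⊢
    -- Metric compatibility has replaced the derivatives of G by Γ. After antisymmetrizing in x and
    -- y, what remains vanishes by the symmetry of G and of the Hessian of ½ log a.
    linear_combination e1 - e2 - θ z * θ w * H7 x y + G u z w * H6 x y

end Smooth

end LocalMetric

/-! ### The metric in the preferred chart. -/

namespace PseudoRiemannianMetric
open Topology

variable {E : Type*} [NormedAddCommGroup E] [NormedSpace ℝ E]
  {M : Type*} [TopologicalSpace M] [ChartedSpace E M] [IsManifold 𝓘(ℝ, E) ∞ M]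

theorem inChart_apply (g : PseudoRiemannianMetric E M) (P : M) (u v w : E) :
    g.inChart P u v w =
      g.val ((chartAt E P).symm u) (chartSymmDeriv P u v) (chartSymmDeriv P u w) := rfl

/-- The tangent space at P is identified with E by this very chart, in which the inverse chart reads
as the identity near the base point. -/
theorem chartSymmDeriv_chartAt (P : M) :
    chartSymmDeriv P (chartAt E P P) = ContinuousLinearMap.id ℝ E := by
  have hmem := mem_chart_target E P
  have hd : MDifferentiableAt 𝓘(ℝ, E) 𝓘(ℝ, E) (chartAt E P).symm (chartAt E P P) :=
    mdifferentiableAt_atlas_symm (chart_mem_atlas E P) hmem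
  have h : writtenInExtChartAt 𝓘(ℝ, E) 𝓘(ℝ, E) (chartAt E P P) (chartAt E P).symm
      =ᶠ[𝓝 (chartAt E P P)] id := by
    filter_upwards [(chartAt E P).open_target.mem_nhds hmem] with u hu
    simp [writtenInExtChartAt, chartAt_self_eq, (chartAt E P).left_inv (mem_chart_source E P),
      (chartAt E P).right_inv hu]
  rw [chartSymmDeriv, hd.mfderiv]
  simp only [modelWithCornersSelf_coe, Set.range_id, fderivWithin_univ, extChartAt_model_space_eq_id,
    PartialEquiv.refl_coe, id]
  rw [h.fderiv_eq, fderiv_id]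

theorem inChart_chartAt (g : PseudoRiemannianMetric E M) (P : M) (v w : E) :
    g.inChart P (chartAt E P P) v w = g.val P v w := by
  rw [inChart_apply, chartSymmDeriv_chartAt]
  -- φ⁻¹(φ(P)) equals P only propositionally, so the fibre is changed by substitution.
  have h (Q : M) (hQ : Q = P) : g.val Q v w = g.val P v w := by subst hQ; rfl
  exact h _ ((chartAt E P).left_inv (mem_chart_source E P))

variable [FiniteDimensional ℝ E]

/-- In finite dimension it suffices to treat each coefficient, which pairs the smooth section g with
two smooth vector fields along the inverse chart, the images of constant fields under its tangent
map. -/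
theorem contDiffOn_inChart (g : PseudoRiemannianMetric E M) (P : M) :
    ContDiffOn ℝ ∞ (g.inChart P) (chartAt E P).target := by
  rw [contDiffOn_clm_apply]
  intro v
  rw [contDiffOn_clm_apply]
  intro w
  rw [← contMDiffOn_iff_contDiffOn]
  have hsymm : ContMDiffOn 𝓘(ℝ, E) 𝓘(ℝ, E) ∞ (chartAt E P).symm (chartAt E P).target :=
    contMDiffOn_chart_symm
  have hv (v : E) : ContMDiffOn 𝓘(ℝ, E) 𝓘(ℝ, E).tangent ∞
      (fun u => (⟨(chartAt E P).symm u, chartSymmDeriv P u v⟩ : TangentBundle 𝓘(ℝ, E) M))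
      (chartAt E P).target := by
    have h := hsymm.contMDiffOn_tangentMapWithin (m := ∞) (by simp)
      (chartAt E P).open_target.uniqueMDiffOn
    have hs : ContMDiff 𝓘(ℝ, E) 𝓘(ℝ, E).tangent ∞
        (fun u => (⟨u, v⟩ : TangentBundle 𝓘(ℝ, E) E)) :=
      contMDiff_vectorSpace_iff_contDiff.2 contDiff_const
    refine (h.comp hs.contMDiffOn fun u hu => hu).congr fun u hu => ?_
    simp [tangentMapWithin, chartSymmDeriv, mfderivWithin_of_isOpen (chartAt E P).open_target hu]
    rfl
  have key : ContMDiffOn 𝓘(ℝ, E) (𝓘(ℝ, E).prod 𝓘(ℝ, ℝ)) ∞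
      (fun u => Bundle.TotalSpace.mk' ℝ (E := Bundle.Trivial M ℝ) ((chartAt E P).symm u)
        (g.val ((chartAt E P).symm u) (chartSymmDeriv P u v) (chartSymmDeriv P u w)))
      (chartAt E P).target := by
    apply ContMDiffOn.clm_bundle_apply₂ (F₁ := E) (F₂ := E)
    · exact g.contMDiff.comp_contMDiffOn hsymm
    · exact hv v
    · exact hv w
  intro u hu
  have := key u hu
  simp only [Bundle.contMDiffWithinAt_totalSpace] at this
  exact this.2

theorem contDiffAt_inChart (g : PseudoRiemannianMetric E M) (P : M) :
    ContDiffAt ℝ 2 (g.inChart P) (chartAt E P P) :=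
  ((g.contDiffOn_inChart P).contDiffAt
    ((chartAt E P).open_target.mem_nhds (mem_chart_target E P))).of_le ENat.LEInfty.out

theorem isInvertible_inChart (g : PseudoRiemannianMetric E M) (P : M) :
    (g.inChart P (chartAt E P P)).IsInvertible := by
  have hinj : Function.Injective (g.inChart P (chartAt E P P)) := by
    rw [injective_iff_map_eq_zero]
    intro v hv
    refine g.nondeg P v fun w => ?_
    exact (g.inChart_chartAt P v w).symm.trans (by rw [hv]; rfl)
  have hrank : Module.finrank ℝ E = Module.finrank ℝ (E →L[ℝ] ℝ) := by
    rw [← (LinearMap.toContinuousLinearMap (𝕜 := ℝ) (E := E) (F' := ℝ)).finrank_eq]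
    exact (Subspace.dual_finrank_eq).symm
  exact ⟨(LinearEquiv.ofInjectiveOfFinrankEq (g.inChart P (chartAt E P P)).toLinearMap hinj
    hrank).toContinuousLinearEquiv, by ext; rfl⟩

end PseudoRiemannianMetric

/-! ### Conformal scalings of metrics on the manifold. -/

namespace PseudoRiemannianMetric
open Topology

variable {E : Type*} [NormedAddCommGroup E] [NormedSpace ℝ E]
  {M : Type*} [TopologicalSpace M] [ChartedSpace E M] [IsManifold 𝓘(ℝ, E) ∞ M]
  {α : M → ℝ} {g₁ g₂ : PseudoRiemannianMetric E M}

theorem IsConformalScaling.inChart_eq (h : IsConformalScaling α g₁ g₂) (P : M) :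
    g₁.inChart P = fun u => α ((chartAt E P).symm u) • g₂.inChart P u := by
  funext u
  ext v w
  exact h.2.2 _ _ _

theorem IsConformalScaling.formAt_eq (h : IsConformalScaling α g₁ g₂) (P : M) :
    g₁.formAt P = α P • g₂.formAt P := by
  ext v w
  exact h.2.2 P v w

theorem IsConformalScaling.contDiffAt (h : IsConformalScaling α g₁ g₂) (P : M) :
    ContDiffAt ℝ 2 (fun u => α ((chartAt E P).symm u)) (chartAt E P P) := by
  have h1 : ContMDiffOn 𝓘(ℝ, E) 𝓘(ℝ, ℝ) ∞ (fun u => α ((chartAt E P).symm u))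
      (chartAt E P).target :=
    h.1.comp_contMDiffOn contMDiffOn_chart_symm
  exact ((contMDiffOn_iff_contDiffOn.1 h1).contDiffAt
    ((chartAt E P).open_target.mem_nhds (mem_chart_target E P))).of_le ENat.LEInfty.out

variable [FiniteDimensional ℝ E]

theorem IsConformalScaling.exists_isConformalChange (h : IsConformalScaling α g₁ g₂) (P : M) :
    ∃ S : LinearMap.BilinForm ℝ (TangentSpace 𝓘(ℝ, E) P),
      (g₁.riemannTriple P).IsConformalChange (g₂.riemannTriple P) (α P) S := by
  obtain ⟨S, hS⟩ := LocalMetric.exists_apply_curvature_smul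
    (fun u v w => g₂.symm ((chartAt E P).symm u) (chartSymmDeriv P u v) (chartSymmDeriv P u w))
    (g₂.contDiffAt_inChart P) (g₂.isInvertible_inChart P) (h.contDiffAt P) fun u => h.2.1 _
  -- At the base point the chart metric is g₂ at P itself, so the coordinate identity becomes one on
  -- T_P M.
  simp only [inChart_chartAt, ← h.inChart_eq] at hS
  refine ⟨S, (h.2.1 P).ne', h.formAt_eq P, fun x y z w => ?_⟩
  exact (h.2.2 P _ _).trans (congrArg (α P * ·) (hS x y z w))

theorem IsConformalScaling.weylAt_eq (h : IsConformalScaling α g₁ g₂)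
    (hdim : 3 ≤ Module.finrank ℝ E) (P : M) : g₁.weylAt P = α P • g₂.weylAt P := by
  obtain ⟨S, hS⟩ := h.exists_isConformalChange P
  exact hS.weyl_eq hdim

end PseudoRiemannianMetric

/-! ### The main theorem. -/

theorem theorem1p1 {E : Type*} [NormedAddCommGroup E] [NormedSpace ℝ E] [FiniteDimensional ℝ E]
    {M : Type*} [TopologicalSpace M] [ChartedSpace E M] [IsManifold 𝓘(ℝ, E) ∞ M]
    (hdim : 3 ≤ Module.finrank ℝ E) (g₁ g₂ : PseudoRiemannianMetric E M)
    (hconf : PseudoRiemannianMetric.ConformallyEquivalent g₁ g₂) :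
    (∀ α : M → ℝ, PseudoRiemannianMetric.IsConformalScaling α g₁ g₂ →
      ∀ P : M, g₁.weylAt P = α P • g₂.weylAt P) ∧
    (g₁.IsConformallySpacelikeJordanOsserman ↔ g₂.IsConformallySpacelikeJordanOsserman) ∧
    (g₁.IsConformallyTimelikeJordanOsserman ↔ g₂.IsConformallyTimelikeJordanOsserman) ∧
    (g₁.IsConformallySpacelikeJordanIvanovPetrova ↔
      g₂.IsConformallySpacelikeJordanIvanovPetrova) ∧
    (g₁.IsConformallyTimelikeJordanIvanovPetrova ↔
      g₂.IsConformallyTimelikeJordanIvanovPetrova) := by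
  refine ⟨fun α h P => h.weylAt_eq hdim P, ?_⟩
  obtain ⟨α, h⟩ := hconf
  have ha := h.2.1
  have hg (P : M) : (g₁.weylTripleAt P).g = α P • (g₂.weylTripleAt P).g := h.formAt_eq P
  have hA (P : M) : (g₁.weylTripleAt P).A = α P • (g₂.weylTripleAt P).A := h.weylAt_eq hdim P
  have hs (P : M) := CurvatureTriple.scaling_symm (ha P) (hg P) (hA P)
  -- Forward implications use the scaling by (α P)⁻¹ from g₁ to g₂, converses the scaling by α P.
  -- The last argument 1 or -1 selects spacelike or timelike.
  refine ⟨forall_congr' fun P => ⟨?_, ?_⟩, forall_congr' fun P => ⟨?_, ?_⟩,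
    forall_congr' fun P => ⟨?_, ?_⟩, forall_congr' fun P => ⟨?_, ?_⟩⟩
  · exact CurvatureTriple.jordanOsserman_of_scaling (hs P).1 (hs P).2.1 (hs P).2.2 1
  · exact CurvatureTriple.jordanOsserman_of_scaling (ha P) (hg P) (hA P) 1
  · exact CurvatureTriple.jordanOsserman_of_scaling (hs P).1 (hs P).2.1 (hs P).2.2 (-1)
  · exact CurvatureTriple.jordanOsserman_of_scaling (ha P) (hg P) (hA P) (-1)
  · exact CurvatureTriple.jordanIvanovPetrova_of_scaling (hs P).1 (hs P).2.1 (hs P).2.2 1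
  · exact CurvatureTriple.jordanIvanovPetrova_of_scaling (ha P) (hg P) (hA P) 1
  · exact CurvatureTriple.jordanIvanovPetrova_of_scaling (hs P).1 (hs P).2.1 (hs P).2.2 (-1)
  · exact CurvatureTriple.jordanIvanovPetrova_of_scaling (ha P) (hg P) (hA P) (-1)
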